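/- Let $c$, $e\neq 0$, $m>1$ and $p>1$ be integers, and let $d$ be a positive rational such that $dm$ and $dcm/e$ are non-negative integers, $c+\frac{dcm}{e}-1>0$ and $e+dm^2-1>0$. Set $$a=\frac{e-\sqrt{e^2+\frac{4e}{cp^2}}}{2},\qquad b=\frac{e+\sqrt{e^2+\frac{4e}{cp^2}}}{2}$$ (the hypotheses force $c\ne 0$, and the radicand is non-negative), and write $(z;q)_0=1$, $(z;q)_n=\prod_{k=0}^{n-1}(1-zq^k)$ for $n\ge 1$. Then the infinite continued fraction $$\Big[0;\overline{p-1,\,1,\,c+\tfrac{dc}{e}m^{2n-1}-1,\,p-1,\,1,\,e+dm^{2n}-1}\,\Big]_{n=1}^{\infty},$$ whose partial quotients after $0$ are the six listed numbers for $n=1$, followed by those for $n=2$, and so on, converges, and its value is $$\frac1p+\frac{e/(cp^2)}{md+a}\cdot\frac{\displaystyle\sum_{n=0}^{\infty}\frac{(b/d)^n\,m^{-n(n+3)/2}}{(1/m;1/m)_n\,\big(-a/(dm^2);1/m\big)_n}}{\displaystyle\sum_{n=0}^{\infty}\frac{(b/d)^n\,m^{-n(n+1)/2}}{(1/m;1/m)_n\,\big(-a/(dm);1/m\big)_n}}.$$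 Here $md+a\neq0$, none of the $q$-products vanishes, both series converge, and the series in the denominator has non-zero sum. -/

import Mathlib

open Filter Topology

/-- The infinite simple continued fraction `[h; b 0, b 1, b 2, …]`, all of whose partial numerators
are `1`. -/
def infSimpContFract (h : ℝ) (b : ℕ → ℝ) : SimpContFract ℝ :=
  ⟨⟨h, Stream'.Seq.ofStream (fun k => (⟨1, b k⟩ : GenContFract.Pair ℝ))⟩, by
    intro n x hx
    have h1 : some (1 : ℝ) = some x := hx
    exact (Option.some.inj h1).symm⟩

/-- The `k`-th term (`k ≥ 0`) of the sequence obtained by listing, for `n = 1, 2, 3, …`, the six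
numbers `p - 1, 1, c + (d c / e) m ^ (2 n - 1) - 1, p - 1, 1, e + d m ^ (2 n) - 1`. The terms
`k = 6 (n - 1), …, 6 (n - 1) + 5` form the `n`-th block. -/
noncomputable def blockQuotient (c e m p d : ℝ) (k : ℕ) : ℝ :=
  let n := k / 6 + 1
  match k % 6 with
  | 0 => p - 1
  | 1 => 1
  | 2 => c + d * c / e * m ^ (2 * n - 1) - 1
  | 3 => p - 1
  | 4 => 1
  | _ => e + d * m ^ (2 * n) - 1

/-- The finite `q`-product `(z; q)_n = ∏_{k = 0}^{n - 1} (1 - z q ^ k)`. -/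
noncomputable def qProd (z q : ℝ) (n : ℕ) : ℝ :=
  ∏ k ∈ Finset.range n, (1 - z * q ^ k)

/-- The `n`-th term of the series in the numerator. The division `n * (n + 3) / 2` of natural
numbers is exact. -/
noncomputable def numTerm (a b d m : ℝ) (n : ℕ) : ℝ :=
  (b / d) ^ n * (m ^ (n * (n + 3) / 2))⁻¹ /
    (qProd (1 / m) (1 / m) n * qProd (-a / (d * m ^ 2)) (1 / m) n)

/-- The `n`-th term of the series in the denominator. The division `n * (n + 1) / 2` of natural
numbers is exact. -/
noncomputable def denTerm (a b d m : ℝ) (n : ℕ) : ℝ :=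
  (b / d) ^ n * (m ^ (n * (n + 1) / 2))⁻¹ /
    (qProd (1 / m) (1 / m) n * qProd (-a / (d * m)) (1 / m) n)

/-! The identity `(p-1) + 1/(1 + 1/(w-1)) = p - 1/w` with `w = u + 1/p` contracts each triple `p-1,
1, Y-1` to one step of `u k = Y k + p⁻² / u (k+1)`, the value being `1/p + p⁻² / u 0`. Here `Y k` is
`e + d m^(k+1)` times a factor alternating between `c/e` and `1`. Removing these factors leaves `U k
= e + d m^(k+1) + l / U (k+1)` with `l = e/(c p²)`, where `a + b = e` and `-a b = l`.

With `F = thetaSum`, `q = 1/m` and `x = 1/(d m^k)`, the `q`-difference equation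
`thetaSum_recurrence` says that `(d m^(k+1) + a) F(x) / F(xq)` solves this recurrence. The solution
is positive because `b > 0` and `d m^(k+1) + a > 0` (`mul_pow_add_pos`). Positivity makes all
complete quotients exceed `1`, so the partial quotients are those of the regular expansion of the
claimed value, which converges to it. -/

/-- The sequence of terms of the basic hypergeometric series
`∑ (b x) ^ n q ^ (n (n + 1) / 2) / ((q; q)_n (-a x q; q)_n)`. -/
noncomputable def thetaTerm (a b q x : ℝ) (n : ℕ) : ℝ :=
  (b * x) ^ n * q ^ (n * (n + 1) / 2) / (qProd q q n * qProd (-(a * x * q)) q n)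

/-- The sum of the series with terms `thetaTerm`. -/
noncomputable def thetaSum (a b q x : ℝ) : ℝ :=
  ∑' n, thetaTerm a b q x n

/-! ### Finite `q`-products and triangular exponents -/

theorem qProd_succ (z q : ℝ) (n : ℕ) : qProd z q (n + 1) = qProd z q n * (1 - z * q ^ n) := by
  simp [qProd, Finset.prod_range_succ]

theorem qProd_succ' (z q : ℝ) (n : ℕ) :
    qProd z q (n + 1) = (1 - z) * qProd (z * q) q n := by
  simp only [qProd, Finset.prod_range_succ', pow_zero, mul_one]
  rw [mul_comm]
  congr 1
  exact Finset.prod_congr rfl fun k _ => by ring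

theorem qProd_pos {z q : ℝ} (h : ∀ k : ℕ, 0 < 1 - z * q ^ k) (n : ℕ) : 0 < qProd z q n :=
  Finset.prod_pos fun k _ => h k

theorem qProd_self_pos {q : ℝ} (h0 : 0 < q) (h1 : q < 1) (n : ℕ) : 0 < qProd q q n :=
  qProd_pos (fun k => by
    have := pow_lt_one₀ h0.le h1 (Nat.succ_ne_zero k)
    rw [pow_succ'] at this
    linarith) n

theorem triangle_succ (n : ℕ) : (n + 1) * (n + 1 + 1) / 2 = n * (n + 1) / 2 + (n + 1) := by
  have : (n + 1) * (n + 1 + 1) = n * (n + 1) + (n + 1) * 2 := by ring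
  rw [this, Nat.add_mul_div_right _ _ two_pos]

theorem mul_add_three_div_two (n : ℕ) : n * (n + 3) / 2 = n + n * (n + 1) / 2 := by
  have : n * (n + 3) = n * (n + 1) + n * 2 := by ring
  rw [this, Nat.add_mul_div_right _ _ two_pos, add_comm]

/-! ### The basic hypergeometric series and its `q`-difference equation -/

section theta

variable {a b q x : ℝ}

theorem qProd_shift_pos (h : ∀ k : ℕ, 0 < 1 + a * x * q ^ (k + 1)) (n : ℕ) :
    0 < qProd (-(a * x * q)) q n :=
  qProd_pos (fun k => by convert h k using 1; ring) n

theorem shift_hyp (h : ∀ k : ℕ, 0 < 1 + a * x * q ^ (k + 1)) (k : ℕ) :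
    0 < 1 + a * (x * q) * q ^ (k + 1) := by
  convert h (k + 1) using 1; ring

theorem thetaTerm_zero : thetaTerm a b q x 0 = 1 := by
  simp [thetaTerm, qProd]

theorem thetaTerm_pos (h0 : 0 < q) (h1 : q < 1) (hb : 0 < b) (hx : 0 < x)
    (h : ∀ k : ℕ, 0 < 1 + a * x * q ^ (k + 1)) (n : ℕ) : 0 < thetaTerm a b q x n :=
  div_pos (by positivity) (mul_pos (qProd_self_pos h0 h1 n) (qProd_shift_pos h n))

theorem thetaTerm_succ (n : ℕ) :
    thetaTerm a b q x (n + 1) = thetaTerm a b q x n *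
      (b * x * q ^ (n + 1) / ((1 - q ^ (n + 1)) * (1 + a * x * q ^ (n + 1)))) := by
  rw [thetaTerm, thetaTerm, div_mul_div_comm, triangle_succ, qProd_succ, qProd_succ]
  congr 1 <;> ring

theorem summable_thetaTerm (h0 : 0 < q) (h1 : q < 1) (hb : 0 < b) (hx : 0 < x)
    (h : ∀ k : ℕ, 0 < 1 + a * x * q ^ (k + 1)) : Summable (thetaTerm a b q x) := by
  refine summable_of_ratio_test_tendsto_lt_one (l := 0) zero_lt_one
    (Eventually.of_forall fun n => (thetaTerm_pos h0 h1 hb hx h n).ne') ?_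
  have hq : Tendsto (fun n : ℕ => q ^ (n + 1)) atTop (𝓝 0) :=
    (tendsto_pow_atTop_nhds_zero_of_lt_one h0.le h1).comp (tendsto_add_atTop_nat 1)
  have hlim : Tendsto (fun n : ℕ => b * x * q ^ (n + 1) /
      ((1 - q ^ (n + 1)) * (1 + a * x * q ^ (n + 1)))) atTop (𝓝 0) := by
    have := (hq.const_mul (b * x)).div
      ((hq.const_sub 1).mul ((hq.const_mul (a * x)).const_add 1)) (by simp)
    rw [mul_zero, zero_div] at this
    exact this
  refine (hlim.norm.congr fun n => ?_).trans (by simp)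
  rw [thetaTerm_succ, norm_mul, mul_div_cancel_left₀]
  exact norm_ne_zero_iff.2 (thetaTerm_pos h0 h1 hb hx h n).ne'

theorem thetaSum_pos (h0 : 0 < q) (h1 : q < 1) (hb : 0 < b) (hx : 0 < x)
    (h : ∀ k : ℕ, 0 < 1 + a * x * q ^ (k + 1)) : 0 < thetaSum a b q x :=
  (summable_thetaTerm h0 h1 hb hx h).tsum_pos
    (fun n => (thetaTerm_pos h0 h1 hb hx h n).le) 0 (thetaTerm_pos h0 h1 hb hx h 0)

/-- Coefficient form of the `q`-difference equation. The index shift on the left absorbs the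
constant terms, which are both `1` and cancel. -/
theorem thetaTerm_recurrence (h0 : 0 < q) (h1 : q < 1)
    (h : ∀ k : ℕ, 0 < 1 + a * x * q ^ (k + 1)) (n : ℕ) :
    (1 + a * x * q) * (thetaTerm a b q x (n + 1) - thetaTerm a b q (x * q) (n + 1)) =
      b * x * q * thetaTerm a b q (x * q) n -
        a * b * x ^ 2 * q ^ 3 / (1 + a * x * q ^ 2) * thetaTerm a b q (x * q * q) n := by
  -- All shifted products are expressed through `(-a x q²; q)_n`, so that only a rational identity
  -- in `q ^ n` remains.
  have e1 : qProd (-(a * x * q)) q (n + 1) = (1 + a * x * q) * qProd (-(a * (x * q) * q)) q n := by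
    rw [qProd_succ']; congr 2 <;> ring
  have e2 : qProd (-(a * (x * q) * q)) q (n + 1) =
      qProd (-(a * (x * q) * q)) q n * (1 + a * x * q ^ (n + 2)) := by
    rw [qProd_succ]; ring
  have e3 : qProd (-(a * (x * q * q) * q)) q n =
      qProd (-(a * (x * q) * q)) q n * (1 + a * x * q ^ (n + 2)) / (1 + a * x * q ^ 2) := by
    rw [eq_div_iff (h 1).ne', ← e2, qProd_succ', mul_comm]
    congr 2 <;> ring
  have hP := (qProd_shift_pos (shift_hyp h) n).ne'
  have hQ := (qProd_self_pos h0 h1 n).ne'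
  have p1 : 1 + a * x * q ≠ 0 := by simpa using (h 0).ne'
  have p2 := (h 1).ne'
  have p3 := (h (n + 1)).ne'
  have p4 : 1 - q ^ (n + 1) ≠ 0 := (sub_pos.2 (pow_lt_one₀ h0.le h1 n.succ_ne_zero)).ne'
  have e4 : qProd q q (n + 1) = qProd q q n * (1 - q ^ (n + 1)) := by
    rw [qProd_succ]; ring
  simp only [thetaTerm, e1, e2, e3, e4, triangle_succ]
  generalize qProd (-(a * (x * q) * q)) q n = P at *
  generalize qProd q q n = Q at *
  rw [pow_add q (n * (n + 1) / 2) (n + 1)]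
  generalize q ^ (n * (n + 1) / 2) = T at *
  simp only [mul_pow, pow_succ, pow_zero, one_mul] at p2 p3 p4 ⊢
  generalize q ^ n = r at *
  have p2' : 1 + a * x * q ^ 2 ≠ 0 := by rwa [pow_two]
  have p3' : 1 + a * x * q ^ 2 * r ≠ 0 := by convert p3 using 1; ring
  have p4' : 1 - q * r ≠ 0 := by rwa [mul_comm]
  field_simp
  ring

/-- The `q`-difference equation of `thetaSum`. -/
theorem thetaSum_recurrence (h0 : 0 < q) (h1 : q < 1) (hb : 0 < b) (hx : 0 < x)
    (h : ∀ k : ℕ, 0 < 1 + a * x * q ^ (k + 1)) :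
    (1 + a * x * q) * thetaSum a b q x = (1 + a * x * q + b * x * q) * thetaSum a b q (x * q) -
      a * b * x ^ 2 * q ^ 3 / (1 + a * x * q ^ 2) * thetaSum a b q (x * q * q) := by
  have s0 := summable_thetaTerm h0 h1 hb hx h
  have s1 := summable_thetaTerm h0 h1 hb (mul_pos hx h0) (shift_hyp h)
  have s2 := summable_thetaTerm h0 h1 hb (mul_pos (mul_pos hx h0) h0) (shift_hyp (shift_hyp h))
  have key : (1 + a * x * q) * (thetaSum a b q x - thetaSum a b q (x * q)) =
      b * x * q * thetaSum a b q (x * q) -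
        a * b * x ^ 2 * q ^ 3 / (1 + a * x * q ^ 2) * thetaSum a b q (x * q * q) := by
    simp only [thetaSum]
    rw [← s0.tsum_sub s1, (s0.sub s1).tsum_eq_zero_add, thetaTerm_zero, thetaTerm_zero, sub_self,
      zero_add, ← tsum_mul_left, ← tsum_mul_left (a := b * x * q), ← tsum_mul_left,
      ← (s1.mul_left _).tsum_sub (s2.mul_left _)]
    exact tsum_congr fun n => thetaTerm_recurrence h0 h1 h n
  linear_combination key

end theta

/-! ### Convergence from complete quotients, and contraction of blocks -/

/-- A continued fraction with integer partial quotients and complete quotients `t k > 1` converges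
to the number with these complete quotients. -/
theorem tendsto_convs_of_complete_quotients {B t : ℕ → ℝ} (hB : ∀ k, ∃ z : ℤ, B k = z)
    (ht : ∀ k, 1 < t k) (hrec : ∀ k, t k = B k + (t (k + 1))⁻¹) :
    Tendsto (infSimpContFract 0 B).val.convs atTop (𝓝 (t 0)⁻¹) := by
  choose z hz using hB
  -- Since `0 < 1 / t k < 1`, the floor algorithm run on `(t 0)⁻¹` has to return exactly the `B k`.
  have hfloor : ∀ k (w : ℤ) (y : ℝ), y = w + (t k)⁻¹ → ⌊y⌋ = w ∧ Int.fract y = (t k)⁻¹ := by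
    intro k w y hy
    have h1 : 0 < (t k)⁻¹ := inv_pos.2 (zero_lt_one.trans (ht k))
    have h2 : (t k)⁻¹ < 1 := inv_lt_one_of_one_lt₀ (ht k)
    have : ⌊y⌋ = w := Int.floor_eq_iff.2 ⟨by linarith, by linarith⟩
    refine ⟨this, ?_⟩
    rw [Int.fract, this, hy]; ring
  have h0 := hfloor 0 0 (t 0)⁻¹ (by simp)
  have hs : ∀ k, GenContFract.IntFractPair.stream (t 0)⁻¹ (k + 1) = some ⟨z k, (t (k + 1))⁻¹⟩ := by
    intro k
    have hstep := fun k => hfloor (k + 1) (z k) (t k) (by rw [← hz]; exact hrec k)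
    have hne := fun k => (inv_pos.2 (zero_lt_one.trans (ht k))).ne'
    induction k with
    | zero =>
      rw [GenContFract.IntFractPair.stream_succ_of_some (GenContFract.IntFractPair.stream_zero _)
        (by rw [GenContFract.IntFractPair.of, h0.2]; exact hne 0)]
      simp only [GenContFract.IntFractPair.of, h0.2, inv_inv, hstep 0]
    | succ k ih =>
      rw [GenContFract.IntFractPair.stream_succ_of_some ih (hne (k + 1))]
      simp only [GenContFract.IntFractPair.of, inv_inv, hstep (k + 1)]
  have hof : (infSimpContFract 0 B).val = GenContFract.of (t 0)⁻¹ := by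
    refine GenContFract.ext ?_ ?_
    · rw [GenContFract.of_h_eq_floor, h0.1, Int.cast_zero]; rfl
    · refine Stream'.Seq.ext fun k => ?_
      rw [GenContFract.get?_of_eq_some_of_succ_get?_intFractPair_stream (hs k), ← hz]
      rfl
  rw [hof]
  exact GenContFract.of_convergence _

/-- Convergence of continued fractions composed of blocks `p - 1, 1, Y k - 1`. -/
theorem tendsto_convs_of_blocks {p : ℤ} {B Y u : ℕ → ℝ} (hp : 1 < p)
    (hB0 : ∀ k, B (3 * k) = p - 1) (hB1 : ∀ k, B (3 * k + 1) = 1)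
    (hB2 : ∀ k, B (3 * k + 2) = Y k - 1) (hY : ∀ k, ∃ z : ℤ, Y k = z ∧ 2 ≤ z)
    (hu : ∀ k, 0 < u k) (hrec : ∀ k, u k = Y k + 1 / (p : ℝ) ^ 2 / u (k + 1)) :
    Tendsto (infSimpContFract 0 B).val.convs atTop (𝓝 (1 / p + 1 / (p : ℝ) ^ 2 / u 0)) := by
  have hp2 : (2 : ℝ) ≤ p := by exact_mod_cast hp
  have hp1 : (0 : ℝ) < p := by linarith
  have hp0 : (p : ℝ) ≠ 0 := hp1.ne'
  obtain ⟨w, hw⟩ : ∃ w : ℕ → ℝ, ∀ k, w k = u k + 1 / p := ⟨_, fun _ => rfl⟩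
  -- This is what makes the complete quotient `w - 1` exceed `1`.
  have hw2 : ∀ k, 2 < w k := by
    intro k
    obtain ⟨z, hz, hz2⟩ := hY k
    have h1 : (2 : ℝ) ≤ Y k := by rw [hz]; exact_mod_cast hz2
    have h2 : 0 < 1 / (p : ℝ) ^ 2 / u (k + 1) := by have := hu (k + 1); positivity
    have h3 : 0 < 1 / (p : ℝ) := by positivity
    rw [hw, hrec]; linarith
  have hinv : ∀ k, (p - (w k)⁻¹)⁻¹ = 1 / p + 1 / (p : ℝ) ^ 2 / u k := by
    intro k
    have h1 := (hu k).ne'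
    have h3 : u k * p + 1 ≠ 0 := by
      have := hu k
      positivity
    rw [hw]
    have h4 : u k + 1 / p = (u k * p + 1) / p := by field_simp
    have h5 : (p : ℝ) - (u k + 1 / p)⁻¹ = p ^ 2 * u k / (u k * p + 1) := by
      rw [h4, inv_div, eq_div_iff h3, sub_mul, div_mul_cancel₀ _ h3]; ring
    rw [h5, inv_div]
    field_simp
  -- Complete quotients within a block: peeling `p - 1` and then `1` off `p - 1/w` leaves `w/(w-1)`
  -- and `w - 1`.
  obtain ⟨t, ht0, ht1, ht2⟩ : ∃ t : ℕ → ℝ, (∀ k, t (3 * k) = p - (w k)⁻¹) ∧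
      (∀ k, t (3 * k + 1) = w k / (w k - 1)) ∧ ∀ k, t (3 * k + 2) = w k - 1 := by
    refine ⟨fun k => if k % 3 = 0 then p - (w (k / 3))⁻¹ else
      if k % 3 = 1 then w (k / 3) / (w (k / 3) - 1) else w (k / 3) - 1, ?_, ?_, ?_⟩ <;> intro k
    · simp
    · simp [show (3 * k + 1) / 3 = k by lia]
    · simp [show (3 * k + 2) / 3 = k by lia]
  have hcase : ∀ k : ℕ, ∃ j, k = 3 * j ∨ k = 3 * j + 1 ∨ k = 3 * j + 2 :=
    fun k => ⟨k / 3, by lia⟩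
  have h0 : (t 0)⁻¹ = 1 / p + 1 / (p : ℝ) ^ 2 / u 0 := by
    rw [← hinv, ← ht0]
  rw [← h0]
  apply tendsto_convs_of_complete_quotients
  · intro k
    obtain ⟨j, rfl | rfl | rfl⟩ := hcase k
    · exact ⟨p - 1, by rw [hB0]; push_cast; rfl⟩
    · exact ⟨1, by rw [hB1]; simp⟩
    · obtain ⟨z, hz, -⟩ := hY j
      exact ⟨z - 1, by rw [hB2, hz]; push_cast; rfl⟩
  · intro k
    obtain ⟨j, rfl | rfl | rfl⟩ := hcase k
    · have := inv_lt_one_of_one_lt₀ (one_lt_two.trans (hw2 j))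
      rw [ht0]; linarith
    · rw [ht1, one_lt_div (by linarith [hw2 j])]; linarith
    · rw [ht2]; linarith [hw2 j]
  · intro k
    obtain ⟨j, rfl | rfl | rfl⟩ := hcase k
    · have h1 : w j ≠ 0 := by linarith [hw2 j]
      rw [ht0, ht1, hB0, inv_div]
      field_simp
      ring
    · have h1 : w j - 1 ≠ 0 := by linarith [hw2 j]
      rw [ht1, ht2, hB1]
      field_simp
      ring
    · rw [show 3 * j + 2 + 1 = 3 * (j + 1) by ring, ht0, hinv, ht2, hB2, hw, hrec]
      ring

/-! ### Solving the contracted recurrence by ratios of theta sums -/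

theorem one_add_mul_pos {a d m : ℝ} (hm : 0 < m) (hd : 0 < d)
    (h : ∀ k : ℕ, 0 < d * m ^ (k + 1) + a) (k j : ℕ) :
    0 < 1 + a * (1 / (d * m ^ k)) * (1 / m) ^ (j + 1) := by
  have e : 1 + a * (1 / (d * m ^ k)) * (1 / m) ^ (j + 1) =
      (d * m ^ (k + j + 1) + a) / (d * m ^ (k + j + 1)) := by
    rw [add_assoc k, pow_add m k, one_div_pow]
    field_simp
  rw [e]
  exact div_pos (h _) (by positivity)

/-- The continued fraction `X 1 + l / (X 2 + l / (X 3 + ⋯))` with `X k = a + b + d m ^ k` and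
`l = -a b`, in terms of `thetaSum`. -/
theorem thetaSum_tail {a b d m : ℝ} (hm : 1 < m) (hd : 0 < d) (hb : 0 < b)
    (h : ∀ k : ℕ, 0 < d * m ^ (k + 1) + a) :
    ∃ U : ℕ → ℝ, (∀ k, 0 < U k) ∧
      (∀ k, U k = a + b + d * m ^ (k + 1) + -(a * b) / U (k + 1)) ∧
      U 0 = (m * d + a) * thetaSum a b (1 / m) (1 / d) / thetaSum a b (1 / m) (1 / (d * m)) := by
  have hm0 : 0 < m := zero_lt_one.trans hm
  have h0 : 0 < 1 / m := by positivity
  have h1 : 1 / m < 1 := by rwa [div_lt_one hm0]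
  have hx : ∀ k : ℕ, 0 < 1 / (d * m ^ k) := fun k => by positivity
  have hpos := one_add_mul_pos hm0 hd h
  have hS : ∀ k : ℕ, 0 < thetaSum a b (1 / m) (1 / (d * m ^ k)) := fun k =>
    thetaSum_pos h0 h1 hb (hx k) (hpos k)
  refine ⟨fun k => (d * m ^ (k + 1) + a) * thetaSum a b (1 / m) (1 / (d * m ^ k)) /
    thetaSum a b (1 / m) (1 / (d * m ^ (k + 1))), fun k => ?_, fun k => ?_, ?_⟩
  · exact div_pos (mul_pos (h k) (hS k)) (hS (k + 1))
  · have hr := thetaSum_recurrence h0 h1 hb (hx k) (hpos k)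
    have s1 : 1 / (d * m ^ k) * (1 / m) = 1 / (d * m ^ (k + 1)) := by rw [pow_succ]; field_simp
    have s2 : 1 / (d * m ^ (k + 1)) * (1 / m) = 1 / (d * m ^ (k + 2)) := by
      rw [pow_succ m (k + 1)]; field_simp
    rw [s1, s2] at hr
    have g1 := (h k).ne'
    have g2 := (h (k + 1)).ne'
    have f1 := (hS (k + 1)).ne'
    have f2 := (hS (k + 2)).ne'
    have c1 : 1 + a * (1 / (d * m ^ k)) * (1 / m) = (d * m ^ (k + 1) + a) / (d * m ^ (k + 1)) := by
      rw [pow_succ]; field_simp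
    have c2 : 1 + a * (1 / (d * m ^ k)) * (1 / m) ^ 2 =
        (d * m ^ (k + 2) + a) / (d * m ^ (k + 2)) := by
      rw [pow_add]; field_simp
    have c3 : b * (1 / (d * m ^ k)) * (1 / m) = b / (d * m ^ (k + 1)) := by
      rw [pow_succ]; field_simp
    have c4 : a * b * (1 / (d * m ^ k)) ^ 2 * (1 / m) ^ 3 =
        a * b / (d * m ^ (k + 1)) / (d * m ^ (k + 2)) := by
      rw [pow_add m k 2, pow_succ m k]; field_simp
    rw [c1, c2, c3, c4] at hr
    have z1 : d * m ^ (k + 1) ≠ 0 := by positivity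
    have z2 : d * m ^ (k + 2) ≠ 0 := by positivity
    simp only [show k + 1 + 1 = k + 2 from rfl] at *
    generalize thetaSum a b (1 / m) (1 / (d * m ^ k)) = F0 at *
    generalize thetaSum a b (1 / m) (1 / (d * m ^ (k + 1))) = F1 at *
    generalize thetaSum a b (1 / m) (1 / (d * m ^ (k + 2))) = F2 at *
    generalize d * m ^ (k + 1) = D1 at *
    generalize d * m ^ (k + 2) = D2 at *
    field_simp at hr ⊢
    linear_combination hr
  · simp only [zero_add, pow_one, pow_zero, mul_one]
    rw [mul_comm d m]

/-! ### Matching the stated series and partial quotients -/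

theorem denTerm_eq (a b d m : ℝ) : denTerm a b d m = thetaTerm a b (1 / m) (1 / d) := by
  funext n
  rw [denTerm, thetaTerm, one_div_pow, one_div (m ^ _), mul_one_div b d,
    show -(a * (1 / d) * (1 / m)) = -a / (d * m) by field_simp]

theorem numTerm_eq (a b d m : ℝ) : numTerm a b d m = thetaTerm a b (1 / m) (1 / (d * m)) := by
  funext n
  rw [numTerm, thetaTerm, mul_add_three_div_two, pow_add, one_div_pow, one_div (m ^ _),
    show -(a * (1 / (d * m)) * (1 / m)) = -a / (d * m ^ 2) by field_simp, mul_inv, ← mul_assoc,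
    ← inv_pow, ← mul_pow, show b / d * m⁻¹ = b * (1 / (d * m)) by field_simp]

theorem blockQuotient_three_mul (c e m p d : ℝ) (k : ℕ) :
    blockQuotient c e m p d (3 * k) = p - 1 := by
  have : 3 * k % 6 = 0 ∨ 3 * k % 6 = 3 := by lia
  rcases this with h | h <;> simp [blockQuotient, h]

theorem blockQuotient_three_mul_add_one (c e m p d : ℝ) (k : ℕ) :
    blockQuotient c e m p d (3 * k + 1) = 1 := by
  have : (3 * k + 1) % 6 = 1 ∨ (3 * k + 1) % 6 = 4 := by lia
  rcases this with h | h <;> simp [blockQuotient, h]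

theorem blockQuotient_three_mul_add_two {e : ℝ} (he : e ≠ 0) (c m p d : ℝ) (k : ℕ) :
    blockQuotient c e m p d (3 * k + 2) =
      (if Even k then c / e else 1) * (e + d * m ^ (k + 1)) - 1 := by
  rcases Nat.even_or_odd' k with ⟨j, rfl | rfl⟩
  · have h1 : (3 * (2 * j) + 2) % 6 = 2 := by lia
    have h2 : (3 * (2 * j) + 2) / 6 = j := by lia
    have h3 : 2 * (j + 1) - 1 = 2 * j + 1 := by lia
    simp only [blockQuotient, h1, h2, h3, even_two_mul, if_true]
    field_simp
  · have h1 : (3 * (2 * j + 1) + 2) % 6 = 5 := by lia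
    have h2 : (3 * (2 * j + 1) + 2) / 6 = j := by lia
    have h3 : ¬ Even (2 * j + 1) := by simp
    simp only [blockQuotient, h1, h2, h3, if_false]
    ring_nf

/-! ### Sign analysis and the main theorem -/

/-- The parameter conditions make every number `d m ^ (k + 1) + a` positive. -/
theorem mul_pow_add_pos {D M P a : ℝ} {c e k₁ k₂ : ℤ} (hM : 1 < M) (hP : 2 ≤ P) (hD : 0 < D)
    (he : e ≠ 0) (hc0 : c ≠ 0) (h1 : D * M = k₁) (hce : k₂ * e = c * k₁)
    (hc : 2 ≤ c + k₂) (hl : 0 < (c : ℝ) / e)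
    (ha : a = ((e : ℝ) - √((e : ℝ) ^ 2 + 4 * e / (c * P ^ 2))) / 2) (k : ℕ) :
    0 < D * M ^ (k + 1) + a := by
  have hM0 : 0 < M := zero_lt_one.trans hM
  have hk₁ : 1 ≤ k₁ := by
    have : (0 : ℝ) < k₁ := by rw [← h1]; positivity
    exact_mod_cast this
  have hmono : D * M ≤ D * M ^ (k + 1) :=
    mul_le_mul_of_nonneg_left (le_self_pow₀ hM.le k.succ_ne_zero) hD.le
  have hcabs : (1 : ℝ) ≤ |(c : ℝ)| := by
    rw [← Int.cast_abs]; exact_mod_cast Int.one_le_abs hc0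
  have hbound : 4 * (e : ℝ) / (c * P ^ 2) ≤ |(e : ℝ)| := by
    refine (le_abs_self _).trans ?_
    rw [abs_div, abs_mul, abs_mul, abs_of_pos (by positivity : (0 : ℝ) < P ^ 2),
      abs_of_pos (by norm_num : (0 : ℝ) < 4), div_le_iff₀ (by positivity)]
    have : 4 ≤ |(c : ℝ)| * P ^ 2 := by nlinarith
    nlinarith [abs_nonneg (e : ℝ)]
  -- Hence `a > -1/2` if `e > 0`, and `a > e - 1/2` if `e < 0`; it remains to compare with `D * M =
  -- k₁`.
  have hsqrt : √((e : ℝ) ^ 2 + 4 * e / (c * P ^ 2)) < |(e : ℝ)| + 1 := by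
    rw [Real.sqrt_lt' (by positivity)]
    nlinarith [sq_abs (e : ℝ), abs_nonneg (e : ℝ)]
  rcases lt_or_gt_of_ne he with h | h
  · have hcneg : c < 0 := by
      by_contra hcon
      have h3 : (0 : ℝ) ≤ c := by exact_mod_cast not_lt.1 hcon
      have h4 : (e : ℝ) < 0 := by exact_mod_cast h
      exact absurd hl (not_lt.2 (div_nonpos_of_nonneg_of_nonpos h3 h4.le))
    -- By `hce`, `(c + k₂) e = c (e + k₁)`; the left side is negative and `c < 0`.
    have h5 : 1 ≤ e + k₁ := by
      by_contra hcon
      nlinarith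
    have h6 : (1 : ℝ) ≤ e + k₁ := by exact_mod_cast h5
    have h4 : (e : ℝ) < 0 := by exact_mod_cast h
    rw [abs_of_neg h4] at hsqrt
    linarith
  · have h4 : (0 : ℝ) < e := by exact_mod_cast h
    have h6 : (1 : ℝ) ≤ k₁ := by exact_mod_cast hk₁
    rw [abs_of_pos h4] at hsqrt
    linarith

theorem mainTheorem5 (c e m p : ℤ) (d : ℚ) (a b : ℝ)
    (hm : 1 < m) (hp : 1 < p) (he : e ≠ 0) (hd : 0 < d)
    (hdm : ∃ k : ℕ, d * m = k) (hdcm : ∃ k : ℕ, d * c * m / e = k)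
    (hc : 0 < (c : ℚ) + d * c * m / e - 1) (hem : 0 < (e : ℚ) + d * m ^ 2 - 1)
    (ha : a = ((e : ℝ) - √((e : ℝ) ^ 2 + 4 * e / (c * p ^ 2))) / 2)
    (hb : b = ((e : ℝ) + √((e : ℝ) ^ 2 + 4 * e / (c * p ^ 2))) / 2) :
    -- every square root and denominator in the formula is legitimate
    0 ≤ (e : ℝ) ^ 2 + 4 * e / (c * p ^ 2) ∧
    (m : ℝ) * d + a ≠ 0 ∧
    (∀ n : ℕ, qProd (1 / (m : ℝ)) (1 / m) n ≠ 0 ∧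
      qProd (-a / (d * (m : ℝ) ^ 2)) (1 / m) n ≠ 0 ∧
      qProd (-a / (d * (m : ℝ))) (1 / m) n ≠ 0) ∧
    -- both series converge, and the second sum is not zero
    Summable (numTerm a b d m) ∧ Summable (denTerm a b d m) ∧
    ∑' n, denTerm a b d m n ≠ 0 ∧
    -- the continued fraction converges to the stated value
    Tendsto (infSimpContFract 0 (blockQuotient c e m p d)).val.convs atTop
      (𝓝 (1 / (p : ℝ) + (e : ℝ) / (c * p ^ 2) / (m * d + a) *
        ((∑' n, numTerm a b d m n) / ∑' n, denTerm a b d m n))) := by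
  obtain ⟨k₁, h₁⟩ := hdm
  obtain ⟨k₂, h₂⟩ := hdcm
  have heq : (e : ℚ) ≠ 0 := by exact_mod_cast he
  have heR : (e : ℝ) ≠ 0 := by exact_mod_cast he
  rw [h₂] at hc
  have hc2 : 2 ≤ c + (k₂ : ℤ) := by
    have : (1 : ℚ) < c + k₂ := by linarith
    exact_mod_cast this
  have hem2 : 2 ≤ e + k₁ * m := by
    have : (1 : ℚ) < e + k₁ * m := by rw [← h₁]; linarith
    exact_mod_cast this
  have hc0 : c ≠ 0 := by
    rintro rfl
    have : (k₂ : ℚ) = 0 := by rw [← h₂]; simp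
    have : k₂ = 0 := by exact_mod_cast this
    simp [this] at hc2
  have hcR : (c : ℝ) ≠ 0 := by exact_mod_cast hc0
  have hce : (k₂ : ℤ) * e = c * (k₁ : ℤ) := by
    have : (k₂ : ℚ) * e = c * k₁ := by
      rw [← h₁, ← h₂]; field_simp
    exact_mod_cast this
  have hmR : (1 : ℝ) < m := by exact_mod_cast hm
  have hpR : (2 : ℝ) ≤ p := by exact_mod_cast hp
  have hdR : (0 : ℝ) < d := by exact_mod_cast hd
  have h₁R : (d : ℝ) * m = k₁ := by exact_mod_cast h₁
  have h₂R : (d : ℝ) * m * (c / e) = k₂ := by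
    have : (d : ℝ) * c * m / e = k₂ := by exact_mod_cast congrArg (Rat.cast (K := ℝ)) h₂
    rw [← this]; ring
  have hm0 : (0 : ℝ) < m := by linarith
  have hp0 : (0 : ℝ) < p := by linarith
  -- The sign of `c / e` comes from the non-negativity of `k₂ = d m (c / e)`.
  have hl : 0 < (c : ℝ) / e := by
    refine lt_of_le_of_ne ?_ (div_ne_zero hcR heR).symm
    refine nonneg_of_mul_nonneg_right (a := (d : ℝ) * m) ?_ (by positivity)
    rw [h₂R]; positivity
  obtain ⟨l, hl_def⟩ : ∃ l : ℝ, l = (e : ℝ) / (c * p ^ 2) := ⟨_, rfl⟩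
  have hlr : l = ((c : ℝ) / e)⁻¹ / (p : ℝ) ^ 2 := by rw [hl_def, inv_div, div_div]
  have hl0 : 0 < l := by rw [hlr]; positivity
  have hposA := mul_pow_add_pos (k₁ := k₁) hmR hpR hdR he hc0 (by exact_mod_cast h₁R) hce hc2 hl ha
  have h4l : 4 * (e : ℝ) / (c * p ^ 2) = 4 * l := by rw [hl_def]; ring
  rw [h4l] at ha hb ⊢
  have hrad : 0 ≤ (e : ℝ) ^ 2 + 4 * l := by positivity
  have hsq := Real.sq_sqrt hrad
  have hab : a + b = e := by rw [ha, hb]; ring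
  have hmul : -(a * b) = l := by rw [ha, hb]; linear_combination hsq / 4
  have hb0 : 0 < b := by
    have : |(e : ℝ)| < √((e : ℝ) ^ 2 + 4 * l) :=
      Real.lt_sqrt_of_sq_lt (by rw [sq_abs]; linarith)
    rw [hb]
    linarith [neg_abs_le (e : ℝ)]
  have hq0 : 0 < 1 / (m : ℝ) := by positivity
  have hq1 : 1 / (m : ℝ) < 1 := by rwa [div_lt_one hm0]
  have hpos : ∀ i j : ℕ, 0 < 1 + a * (1 / (d * (m : ℝ) ^ i)) * (1 / (m : ℝ)) ^ (j + 1) :=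
    fun i j => one_add_mul_pos hm0 hdR hposA i j
  have hpos0 : ∀ j : ℕ, 0 < 1 + a * (1 / (d : ℝ)) * (1 / (m : ℝ)) ^ (j + 1) := fun j => by
    simpa using hpos 0 j
  have hpos1 : ∀ j : ℕ, 0 < 1 + a * (1 / (d * (m : ℝ))) * (1 / (m : ℝ)) ^ (j + 1) := fun j => by
    simpa using hpos 1 j
  obtain ⟨U, hU0, hUrec, hUval⟩ := thetaSum_tail hmR hdR hb0 hposA
  have hmda : (m : ℝ) * d + a ≠ 0 := by
    have := hposA 0
    rw [zero_add, pow_one, mul_comm] at this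
    exact this.ne'
  have hden := thetaSum_pos hq0 hq1 hb0 (by positivity) hpos0
  have hnum := thetaSum_pos hq0 hq1 hb0 (by positivity) hpos1
  rw [numTerm_eq, denTerm_eq]
  refine ⟨hrad, hmda, fun n => ⟨(qProd_self_pos hq0 hq1 n).ne', ?_, ?_⟩,
    summable_thetaTerm hq0 hq1 hb0 (by positivity) hpos1,
    summable_thetaTerm hq0 hq1 hb0 (by positivity) hpos0, hden.ne', ?_⟩
  · have := (qProd_shift_pos hpos1 n).ne'
    rwa [show -(a * (1 / (d * (m : ℝ))) * (1 / m)) = -a / (d * (m : ℝ) ^ 2) by field_simp] at this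
  · have := (qProd_shift_pos hpos0 n).ne'
    rwa [show -(a * (1 / (d : ℝ)) * (1 / m)) = -a / (d * (m : ℝ)) by field_simp] at this
  -- Equivalence transformation: as `s k * s (k + 1) = c / e`, scaling `U k` by `s k` turns the
  -- numerator `l` into `1 / p ^ 2`.
  obtain ⟨s, hs⟩ : ∃ s : ℕ → ℝ, ∀ k, s k = if Even k then (c : ℝ) / e else 1 := ⟨_, fun _ => rfl⟩
  have hs0 : ∀ k, 0 < s k := fun k => by rw [hs]; split_ifs <;> positivity
  have hss : ∀ k, s k * s (k + 1) = (c : ℝ) / e := fun k => by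
    rw [hs, hs]
    by_cases hk : Even k <;> simp [hk, Nat.even_add_one]
  have key := tendsto_convs_of_blocks (B := blockQuotient c e m p d)
    (Y := fun k => s k * (e + d * (m : ℝ) ^ (k + 1))) (u := fun k => s k * U k) hp
    (blockQuotient_three_mul _ _ _ _ _) (blockQuotient_three_mul_add_one _ _ _ _ _)
    (fun k => by rw [blockQuotient_three_mul_add_two heR, hs]) ?_
    (fun k => mul_pos (hs0 k) (hU0 k)) ?_
  · convert key using 3
    rw [hUval, hs, if_pos Even.zero, ← hl_def, hlr]
    simp only [thetaSum] at hden hnum ⊢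
    have h1 := hden.ne'
    have h2 := hnum.ne'
    field_simp
  -- For each parity the integer is smallest at `j = 0`, where the bound is `hc2` or `hem2`.
  · intro k
    rcases Nat.even_or_odd' k with ⟨j, rfl | rfl⟩
    · refine ⟨c + k₂ * m ^ (2 * j), ?_, ?_⟩
      · simp only [hs, even_two_mul, if_true]
        push_cast
        rw [← h₂R]
        field_simp
        ring
      · have h1 : 1 ≤ m ^ (2 * j) := one_le_pow₀ hm.le
        have h2 : (0 : ℤ) ≤ k₂ := by positivity
        nlinarith
    · refine ⟨e + k₁ * m * m ^ (2 * j), ?_, ?_⟩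
      · simp only [hs, show ¬ Even (2 * j + 1) by simp, if_false]
        push_cast
        rw [← h₁R]
        ring
      · have h1 : 1 ≤ m ^ (2 * j) := one_le_pow₀ hm.le
        have h2 : (0 : ℤ) ≤ k₁ * m := by positivity
        nlinarith
  · intro k
    have h1 := (hU0 (k + 1)).ne'
    have h2 := (hs0 (k + 1)).ne'
    have h3 : s k * l = 1 / (p : ℝ) ^ 2 / s (k + 1) := by
      rw [eq_div_iff h2, hlr]
      have := hss k
      have h4 := (hs0 k).ne'
      rw [← this]
      field_simp
    rw [hUrec, hmul, hab, mul_add, mul_div_assoc', h3, div_div]
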